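/- Let $\mathcal H$ be a complex Hilbert space (inner product linear in the second argument) and let $K\in\mathcal B(\mathcal H)$ be boundedly invertible. For a linear operator $T$ in $\mathcal H$ let $K^*TK$ have its natural domain $\{f\in\mathcal H : Kf\in\mathcal D(T)\}$, and call $T$ *$K$-invariant* if $K^*TK=T$ (including $\mathcal D(K^*TK)=\mathcal D(T)$). Let $S$ be a densely defined, closed, symmetric operator in $\mathcal H$ that is $K$-invariant and strictly positive, i.e. $\langle f,Sf\rangle\ge\varepsilon\|f\|^2$ for all $f\in\mathcal D(S)$ and some $\varepsilon>0$. Let $S_F$ be its Friedrichs extension, i.e. the restriction of $S^*$ to those $f\in\mathcal D(S^*)$ for which there is a sequence $(f_n)\subset\mathcal D(S)$ with $f_n\to f$ and $\langle f_n-f_m,S(f_n-f_m)\rangle\to0$ as $n,m\to\infty$. Let $B$ be a linear operator in $\mathcal H$ with $\overline{\mathcal D(B)}\subseteq\ker(S^*)$ and with values in $\overline{\mathcal D(B)}$ such that, as an operator in the Hilbert space $\overline{\mathcal D(B)}$, it is nonnegative self-adjoint or maximally dissipative. (A densely defined operator $A$ is dissipative if $\operatorname{Im}\langle f,Af\rangle\ge0$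 for all $f\in\mathcal D(A)$, and maximally dissipative if in addition it has no nontrivial dissipative extension.) Let $S_B$ be the restriction of $S^*$ to $$\mathcal D(S_B)=\mathcal D(S)\dotplus\{S_F^{-1}Bf+f : f\in\mathcal D(B)\}\dotplus\{S_F^{-1}\eta : \eta\in\mathcal D(B)^\perp\cap\ker(S^*)\}.$$ Then $S_B$ is $K$-invariant if and only if $$\mathcal D(B)=\mathcal D(K^*BK)\qquad\text{and}\qquad P_{\overline{\mathcal D(B)}}\,K^*BK\restriction_{\mathcal D(B)}=B,$$ where $P_{\overline{\mathcal D(B)}}$ is the orthogonal projection onto $\overline{\mathcal D(B)}$. -/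

import Mathlib

open Filter Topology
open scoped LinearPMap

namespace KInvariance

noncomputable section

variable {H : Type*} [NormedAddCommGroup H] [InnerProductSpace ℂ H]

/-- An operator is symmetric if it is densely defined and `⟪S f, g⟫ = ⟪f, S g⟫` on its domain. -/
def IsSymm (S : H →ₗ.[ℂ] H) : Prop :=
  Dense (S.domain : Set H) ∧ S.IsFormalAdjoint S

/-- `⟪f, S f⟫ ≥ 0` on the domain. (For symmetric `S` this inner product is real.) -/
def IsNonneg (S : H →ₗ.[ℂ] H) : Prop :=
  ∀ f : S.domain, 0 ≤ (inner ℂ (f : H) (S f)).re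

/-- `⟪f, S f⟫ ≥ ε ‖f‖²` on the domain, for some `ε > 0`. -/
def IsStrictlyPositive (S : H →ₗ.[ℂ] H) : Prop :=
  ∃ ε : ℝ, 0 < ε ∧ ∀ f : S.domain, ε * ‖(f : H)‖ ^ 2 ≤ (inner ℂ (f : H) (S f)).re

theorem IsStrictlyPositive.isNonneg {S : H →ₗ.[ℂ] H} (h : IsStrictlyPositive S) :
    IsNonneg S := by
  obtain ⟨ε, hε, h⟩ := h
  exact fun f => le_trans (by positivity) (h f)

/-- A densely defined operator with `Im ⟪f, A f⟫ ≥ 0` on its domain. -/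
def IsDissipative (A : H →ₗ.[ℂ] H) : Prop :=
  Dense (A.domain : Set H) ∧ ∀ f : A.domain, 0 ≤ (inner ℂ (f : H) (A f)).im

/-- A dissipative operator without nontrivial dissipative extension. -/
def IsMaximallyDissipative (A : H →ₗ.[ℂ] H) : Prop :=
  IsDissipative A ∧ ∀ A' : H →ₗ.[ℂ] H, A ≤ A' → IsDissipative A' → A' = A

/-- A nonnegative self-adjoint operator. -/
def IsNonnegSelfAdjoint [CompleteSpace H] (A : H →ₗ.[ℂ] H) : Prop :=
  Dense (A.domain : Set H) ∧ A† = A ∧ IsNonneg A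

/-- The kernel of a partially defined operator, as a subspace of `H`. -/
def kernel (T : H →ₗ.[ℂ] H) : Submodule ℂ H :=
  (LinearMap.ker T.toFun).map T.domain.subtype

/-- The operator `K* T K` on its maximal domain `{f | K f ∈ D(T)}`. -/
def conj [CompleteSpace H] (K : H →L[ℂ] H) (T : H →ₗ.[ℂ] H) : H →ₗ.[ℂ] H where
  domain := T.domain.comap (K : H →ₗ[ℂ] H)
  toFun :=
    { toFun := fun f => ContinuousLinearMap.adjoint K (T ⟨K f, f.2⟩)
      map_add' := fun f g => by
        rw [← map_add, ← LinearPMap.map_add]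
        congr 2
        exact Subtype.ext (map_add K (f : H) g)
      map_smul' := fun c f => by
        rw [RingHom.id_apply, ← map_smul, ← LinearPMap.map_smul]
        congr 2
        exact Subtype.ext (map_smul K c (f : H)) }

/-- `T` is `K`-invariant: `K* T K = T`, including equality of domains. -/
def IsKInvariant [CompleteSpace H] (K : H →L[ℂ] H) (T : H →ₗ.[ℂ] H) : Prop :=
  conj K T = T

/-- `f` is the limit in `H` of a sequence in `D(S)` that is Cauchy for the form `⟪·, S ·⟫`. -/
def IsFormLimit (S : H →ₗ.[ℂ] H) (f : H) : Prop :=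
  ∃ u : ℕ → S.domain, Tendsto (fun n => (u n : H)) atTop (𝓝 f) ∧
    Tendsto (fun p : ℕ × ℕ => (inner ℂ ((u p.1 - u p.2 : S.domain) : H)
      (S (u p.1 - u p.2))).re) atTop (𝓝 0)

theorem IsNonneg.re_inner_add_le {S : H →ₗ.[ℂ] H} (hS : IsNonneg S) (a b : S.domain) :
    (inner ℂ ((a + b : S.domain) : H) (S (a + b))).re ≤
      2 * (inner ℂ (a : H) (S a)).re + 2 * (inner ℂ (b : H) (S b)).re := by
  have h := hS (a - b)
  simp only [LinearPMap.map_sub, LinearPMap.map_add, Submodule.coe_sub, Submodule.coe_add,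
    inner_add_left, inner_add_right, inner_sub_left, inner_sub_right, Complex.add_re,
    Complex.sub_re] at h ⊢
  linarith

/-- The closure of `D(S)` with respect to the form of the nonnegative operator `S`. -/
def formClosure (S : H →ₗ.[ℂ] H) (hS : IsNonneg S) : Submodule ℂ H where
  carrier := {f | IsFormLimit S f}
  zero_mem' := ⟨fun _ => 0, by simp, by simp⟩
  add_mem' := by
    rintro f g ⟨u, hu, hu'⟩ ⟨v, hv, hv'⟩
    refine ⟨fun n => u n + v n, by simpa using hu.add hv, ?_⟩
    have h := (hu'.const_mul 2).add (hv'.const_mul 2)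
    rw [mul_zero, add_zero] at h
    refine squeeze_zero (fun p => hS _) (fun p => ?_) h
    rw [add_sub_add_comm]
    exact hS.re_inner_add_le _ _
  smul_mem' := by
    rintro c f ⟨u, hu, hu'⟩
    refine ⟨fun n => c • u n, by simpa using hu.const_smul c, ?_⟩
    have h := hu'.const_mul (‖c‖ ^ 2)
    rw [mul_zero] at h
    refine h.congr fun p => ?_
    rw [← smul_sub, LinearPMap.map_smul, Submodule.coe_smul, inner_smul_left, inner_smul_right,
      ← mul_assoc, Complex.conj_mul', ← Complex.ofReal_pow, Complex.re_ofReal_mul]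

/-- The Friedrichs extension: the restriction of `S*` to the intersection of `D(S*)` with the
form closure of `D(S)`. -/
def friedrichs [CompleteSpace H] (S : H →ₗ.[ℂ] H) (hS : IsNonneg S) : H →ₗ.[ℂ] H :=
  S†.domRestrict (formClosure S hS)

/-- The subspace `{R (B f) + f | f ∈ D(B)}`. -/
def shiftedRange (R B : H →ₗ.[ℂ] H) : Submodule ℂ H where
  carrier := {h | ∃ (f : B.domain) (hf : B f ∈ R.domain), h = R ⟨B f, hf⟩ + f}
  zero_mem' := by
    have h0 : B 0 ∈ R.domain := by simp
    refine ⟨0, h0, ?_⟩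
    have : (⟨B 0, h0⟩ : R.domain) = 0 := Subtype.ext B.map_zero
    rw [this]
    simp
  add_mem' := by
    rintro _ _ ⟨f, hf, rfl⟩ ⟨g, hg, rfl⟩
    have h : B (f + g) ∈ R.domain := by
      rw [LinearPMap.map_add]
      exact add_mem hf hg
    refine ⟨f + g, h, ?_⟩
    have : (⟨B (f + g), h⟩ : R.domain) = ⟨B f, hf⟩ + ⟨B g, hg⟩ := Subtype.ext (B.map_add f g)
    rw [this, LinearPMap.map_add, Submodule.coe_add]
    abel
  smul_mem' := by
    rintro c _ ⟨f, hf, rfl⟩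
    have h : B (c • f) ∈ R.domain := by
      rw [LinearPMap.map_smul]
      exact R.domain.smul_mem c hf
    refine ⟨c • f, h, ?_⟩
    have : (⟨B (c • f), h⟩ : R.domain) = c • ⟨B f, hf⟩ := Subtype.ext (B.map_smul c f)
    rw [this, LinearPMap.map_smul, Submodule.coe_smul, smul_add]

/-- The image `{R η | η ∈ N}` of a subspace under a partially defined operator. -/
def imageOf (R : H →ₗ.[ℂ] H) (N : Submodule ℂ H) : Submodule ℂ H :=
  (N.comap R.domain.subtype).map R.toFun

/-- `D(S) + {S_F⁻¹ B f + f | f ∈ D(B)} + {S_F⁻¹ η | η ∈ D(B)ᗮ ∩ ker S*}`. -/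
def extensionDomain [CompleteSpace H] (S : H →ₗ.[ℂ] H) (hS : IsNonneg S) (B : H →ₗ.[ℂ] H) :
    Submodule ℂ H :=
  S.domain ⊔ shiftedRange (friedrichs S hS).inverse B ⊔
    imageOf (friedrichs S hS).inverse (B.domainᗮ ⊓ kernel S†)

/-- The extension `S_B`: the restriction of `S*` to `extensionDomain S hS B`. -/
def extension [CompleteSpace H] (S : H →ₗ.[ℂ] H) (hS : IsNonneg S) (B : H →ₗ.[ℂ] H) :
    H →ₗ.[ℂ] H :=
  S†.domRestrict (extensionDomain S hS B)

/-- An operator `B` whose values lie in the closure of `D(B)`, viewed as an operator in the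
Hilbert space `closure D(B)`. -/
def inClosure (B : H →ₗ.[ℂ] H) (hB : ∀ f : B.domain, B f ∈ B.domain.topologicalClosure) :
    B.domain.topologicalClosure →ₗ.[ℂ] B.domain.topologicalClosure where
  domain := B.domain.comap B.domain.topologicalClosure.subtype
  toFun :=
    { toFun := fun f => ⟨B ⟨(f : B.domain.topologicalClosure), f.2⟩, hB _⟩
      map_add' := fun f g => Subtype.ext (B.map_add ⟨_, f.2⟩ ⟨_, g.2⟩)
      map_smul' := fun c f => Subtype.ext (B.map_smul c ⟨_, f.2⟩) }

/-- The operator `P_{closure D(B)} T ↾ D(B)`, with `P` the orthogonal projection. -/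
def compression [CompleteSpace H] (B T : H →ₗ.[ℂ] H) : H →ₗ.[ℂ] H :=
  ((B.domain.topologicalClosure.starProjection : H →ₗ[ℂ] H).compPMap T).domRestrict B.domain

end

end KInvariance

/-!
The vectors `x` in the domain of the extension `S_B` are described without reference to the
decomposition that defines it: `x` lies in `D(S_B)` and `S* x = y` if and only if `S* x = y` and
there is `k ∈ D(B)` such that `x - k` belongs to the form closure of `D(S)` and `y - B k` is
orthogonal to `D(B)` (`mem_graph_extension_iff`). This uses three facts about the strictly positive
operator `S`:

* the Friedrichs extension is surjective (`exists_isFormLimit_mem_graph_adjoint`): a minimizing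
  sequence of the functional `v ↦ ⟪v, S v⟫ - 2 Re ⟪h, v⟫` on `D(S)` is Cauchy for the form, and the
  vanishing of the first variation says that its limit `f` satisfies `S* f = h`;
* the Friedrichs extension is injective (`IsFormLimit.eq_zero`), hence
  the form closure of `D(S)` meets `ker S*` only in `0`;
* `ran S` is closed, so it is the orthogonal complement of `ker S*` (`orthogonal_kernel_adjoint`).

If `S` is `K`-invariant, then `K` preserves the form closure of `D(S)`, and `S* x = y` is equivalent
to `S* (K x) = (K⁻¹)* y`. The description above is therefore carried to itself by `K` as soon as `K`
maps `D(B)` into itself with `(K⁻¹)* B k - B K k ⟂ D(B)` for `k ∈ D(B)`, and `K⁻¹` maps `D(B)` into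
itself. Conversely, if `S_B` is `K`-invariant and `k ∈ D(B)`, then `S_F⁻¹ B k + k` is mapped by `K`
into `D(S_B)`, and `form closure ∩ ker S* = 0` identifies `K k` as the element of `D(B)` belonging
to the image. Since invariance under `K` and under `K⁻¹` are the same, everything said about `K`
also holds for `K⁻¹`, which makes both implications symmetric; rewriting the orthogonality relation
with the help of `K* D(B)ᗮ ⊆ D(B)ᗮ` gives the condition on the compression of `K* B K`.

Operators are handled through their graphs throughout, which avoids transporting domain proofs.
-/

open Filter Topology
open scoped LinearPMap

namespace KInvariance

variable {H : Type*} [NormedAddCommGroup H] [InnerProductSpace ℂ H]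

/-! ### Graphs of the operators involved -/

theorem mem_graph_domRestrict_iff (T : H →ₗ.[ℂ] H) (N : Submodule ℂ H) (x y : H) :
    (x, y) ∈ (T.domRestrict N).graph ↔ x ∈ N ∧ (x, y) ∈ T.graph := by
  simp only [LinearPMap.mem_graph_iff]
  constructor
  · rintro ⟨z, rfl, rfl⟩
    exact ⟨z.2.1, ⟨z, z.2.2⟩, rfl, (LinearPMap.domRestrict_apply rfl).symm⟩
  · rintro ⟨hx, z, rfl, rfl⟩
    exact ⟨⟨z, hx, z.2⟩, rfl, LinearPMap.domRestrict_apply rfl⟩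

theorem mem_kernel_iff (T : H →ₗ.[ℂ] H) (x : H) : x ∈ kernel T ↔ (x, 0) ∈ T.graph := by
  simp only [kernel, Submodule.mem_map, LinearMap.mem_ker, LinearPMap.mem_graph_iff]
  exact ⟨fun ⟨z, h, e⟩ => ⟨z, e, h⟩, fun ⟨z, e, h⟩ => ⟨z, h, e⟩⟩

theorem mem_graph_inverse_iff {T : H →ₗ.[ℂ] H} (hT : LinearMap.ker T.toFun = ⊥) (x y : H) :
    (y, x) ∈ T.inverse.graph ↔ (x, y) ∈ T.graph := by
  rw [LinearPMap.inverse_graph hT, Submodule.mem_map]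
  constructor
  · rintro ⟨⟨a, b⟩, h, e⟩
    obtain ⟨rfl, rfl⟩ := Prod.mk.inj e
    exact h
  · exact fun h => ⟨(x, y), h, rfl⟩

theorem mem_shiftedRange_iff (R B : H →ₗ.[ℂ] H) (x : H) :
    x ∈ shiftedRange R B ↔ ∃ (k : B.domain) (a : H), (B k, a) ∈ R.graph ∧ x = a + k := by
  constructor
  · rintro ⟨k, hk, rfl⟩
    exact ⟨k, _, R.mem_graph ⟨B k, hk⟩, rfl⟩
  · rintro ⟨k, a, ha, rfl⟩
    obtain ⟨z, hz, rfl⟩ := (LinearPMap.mem_graph_iff R).1 ha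
    have hz' : B k ∈ R.domain := (show (z : H) = B k from hz) ▸ z.2
    obtain rfl : z = ⟨B k, hz'⟩ := Subtype.ext hz
    exact ⟨k, hz', rfl⟩

theorem mem_imageOf_iff (R : H →ₗ.[ℂ] H) (N : Submodule ℂ H) (x : H) :
    x ∈ imageOf R N ↔ ∃ η ∈ N, (η, x) ∈ R.graph := by
  constructor
  · rintro ⟨z, hz, rfl⟩
    exact ⟨z, hz, R.mem_graph z⟩
  · rintro ⟨η, hη, h⟩
    obtain ⟨z, rfl, rfl⟩ := (LinearPMap.mem_graph_iff R).1 h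
    exact ⟨z, hη, rfl⟩

section Adjoint

variable [CompleteSpace H] {S : H →ₗ.[ℂ] H}

theorem mem_graph_adjoint_iff (hS : Dense (S.domain : Set H)) (x y : H) :
    (x, y) ∈ S†.graph ↔ ∀ v : S.domain, inner ℂ y (v : H) = inner ℂ x (S v) := by
  rw [LinearPMap.mem_graph_iff]
  constructor
  · rintro ⟨z, rfl, rfl⟩ v
    exact LinearPMap.adjoint_isFormalAdjoint hS z v
  · intro h
    exact ⟨⟨x, LinearPMap.mem_adjoint_domain_of_exists x ⟨y, h⟩⟩, rfl,
      LinearPMap.adjoint_apply_eq hS _ h⟩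

theorem IsSymm.mem_graph_adjoint (hS : IsSymm S) (v : S.domain) : ((v : H), S v) ∈ S†.graph :=
  (mem_graph_adjoint_iff hS.1 _ _).2 fun w => hS.2 v w

theorem mem_kernel_adjoint_iff (hS : Dense (S.domain : Set H)) (x : H) :
    x ∈ kernel S† ↔ ∀ v : S.domain, inner ℂ x (S v) = 0 := by
  rw [mem_kernel_iff, mem_graph_adjoint_iff hS]
  simp only [inner_zero_left, eq_comm]

end Adjoint

/-! ### The form closure and the Friedrichs extension -/

theorem IsFormLimit.of_mem_domain {S : H →ₗ.[ℂ] H} (v : S.domain) : IsFormLimit S v :=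
  ⟨fun _ => v, tendsto_const_nhds, by simp⟩

theorem cauchySeq_of_mul_sq_le {E : Type*} [NormedAddCommGroup E] {u : ℕ → E} {q : ℕ × ℕ → ℝ} {ε : ℝ} (hε : 0 < ε)
    (h : ∀ p : ℕ × ℕ, ε * ‖u p.1 - u p.2‖ ^ 2 ≤ q p) (hq : Tendsto q atTop (𝓝 0)) :
    CauchySeq u := by
  rw [cauchySeq_iff_tendsto_dist_atTop_0]
  have h1 : Tendsto (fun p => Real.sqrt (q p / ε)) atTop (𝓝 0) := by
    have := (hq.div_const ε).sqrt
    simpa using this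
  refine squeeze_zero (fun _ => dist_nonneg) (fun p => ?_) h1
  rw [dist_eq_norm]
  refine Real.le_sqrt_of_sq_le ?_
  rw [le_div_iff₀ hε, mul_comm]
  exact h p

section Friedrichs

variable {S : H →ₗ.[ℂ] H}

theorem re_inner_comm (hS : S.IsFormalAdjoint S) (v w : S.domain) :
    (inner ℂ (v : H) (S w)).re = (inner ℂ (w : H) (S v)).re := by
  rw [← hS v w, ← inner_conj_symm, Complex.conj_re]

/-- The functional `v ↦ ⟪v, S v⟫ - 2 Re ⟪h, v⟫`, whose minimizers solve `S v = h`. For symmetric `S`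
the first term is real; taking its real part makes the functional real-valued by definition. -/
noncomputable def energy (S : H →ₗ.[ℂ] H) (h : H) (v : S.domain) : ℝ :=
  (inner ℂ (v : H) (S v)).re - 2 * (inner ℂ h (v : H)).re

theorem energy_add_smul (hS : S.IsFormalAdjoint S) (h : H) (v w : S.domain) (t : ℝ) :
    energy S h (v + (t : ℂ) • w) = energy S h v +
      2 * t * ((inner ℂ (v : H) (S w)).re - (inner ℂ h (w : H)).re) +
      t ^ 2 * (inner ℂ (w : H) (S w)).re := by
  simp only [energy, LinearPMap.map_add, LinearPMap.map_smul, Submodule.coe_add,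
    Submodule.coe_smul, inner_add_left, inner_add_right, inner_smul_left, inner_smul_right,
    Complex.add_re, Complex.conj_ofReal, Complex.re_ofReal_mul, re_inner_comm hS w v]
  ring

theorem bddBelow_range_energy (hpos : IsStrictlyPositive S) (h : H) :
    BddBelow (Set.range (energy S h)) := by
  obtain ⟨ε, hε, hpos⟩ := hpos
  refine ⟨-(‖h‖ ^ 2 / ε), ?_⟩
  rintro _ ⟨v, rfl⟩
  have h1 := hpos v
  have h2 : (inner ℂ h (v : H)).re ≤ ‖h‖ * ‖(v : H)‖ :=
    (Complex.re_le_norm _).trans (norm_inner_le_norm _ _)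
  have h3 : 0 ≤ ε * (‖(v : H)‖ - ‖h‖ / ε) ^ 2 := by positivity
  have h4 : ε * (‖(v : H)‖ - ‖h‖ / ε) ^ 2 =
      ε * ‖(v : H)‖ ^ 2 - 2 * (‖h‖ * ‖(v : H)‖) + ‖h‖ ^ 2 / ε := by
    field_simp
    ring
  unfold energy
  linarith

/-- The parallelogram law for the energy. -/
theorem re_inner_sub_eq (hS : S.IsFormalAdjoint S) (h : H) (v w : S.domain) :
    (inner ℂ ((v - w : S.domain) : H) (S (v - w))).re = 2 * energy S h v + 2 * energy S h w -
      4 * energy S h (w + ((1 / 2 : ℝ) : ℂ) • (v - w)) := by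
  have h1 := energy_add_smul hS h w (v - w) 1
  have h2 := energy_add_smul hS h w (v - w) (1 / 2)
  rw [Complex.ofReal_one, one_smul, add_sub_cancel] at h1
  linarith

/-- The Friedrichs extension of a strictly positive operator is surjective. -/
theorem exists_isFormLimit_mem_graph_adjoint [CompleteSpace H] (hS : IsSymm S)
    (hpos : IsStrictlyPositive S) (h : H) : ∃ f, IsFormLimit S f ∧ (f, h) ∈ S†.graph := by
  have hbdd := bddBelow_range_energy hpos h
  set m := ⨅ v, energy S h v with hm
  have hm_le : ∀ v, m ≤ energy S h v := fun v => ciInf_le hbdd v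
  have hex : ∀ n : ℕ, ∃ v, energy S h v < m + 1 / ((n : ℝ) + 1) := fun n =>
    exists_lt_of_ciInf_lt (lt_add_of_pos_right _ (by positivity))
  choose u hu using hex
  have hδ : Tendsto (fun n : ℕ => 1 / ((n : ℝ) + 1)) atTop (𝓝 0) :=
    tendsto_one_div_add_atTop_nhds_zero_nat
  have hform : Tendsto (fun p : ℕ × ℕ => (inner ℂ ((u p.1 - u p.2 : S.domain) : H)
      (S (u p.1 - u p.2))).re) atTop (𝓝 0) := by
    have hlim : Tendsto (fun p : ℕ × ℕ => 2 * (1 / ((p.1 : ℝ) + 1)) + 2 * (1 / ((p.2 : ℝ) + 1)))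
        atTop (𝓝 0) := by
      rw [← prod_atTop_atTop_eq]
      simpa using ((hδ.comp tendsto_fst).const_mul 2).add ((hδ.comp tendsto_snd).const_mul 2)
    refine squeeze_zero (fun p => hpos.isNonneg _) (fun p => ?_) hlim
    rw [re_inner_sub_eq hS.2 h]
    linarith [hu p.1, hu p.2, hm_le (u p.2 + ((1 / 2 : ℝ) : ℂ) • (u p.1 - u p.2))]
  have hcauchy : CauchySeq fun n => (u n : H) := by
    obtain ⟨ε, hε, hpos⟩ := hpos
    exact cauchySeq_of_mul_sq_le hε (fun p => hpos (u p.1 - u p.2)) hform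
  obtain ⟨f, hf⟩ := cauchySeq_tendsto_of_complete hcauchy
  refine ⟨f, ⟨u, hf, hform⟩, (mem_graph_adjoint_iff hS.1 _ _).2 ?_⟩
  -- The first variation of the energy at the limit `f` in the real direction `w` vanishes.
  have hre : ∀ w : S.domain, (inner ℂ f (S w)).re = (inner ℂ h (w : H)).re := by
    intro w
    set c : ℕ → ℝ := fun n => (inner ℂ (u n : H) (S w)).re - (inner ℂ h (w : H)).re with hc
    have hc_le : ∀ n, c n ^ 2 ≤ (inner ℂ (w : H) (S w)).re * (1 / ((n : ℝ) + 1)) := by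
      intro n
      have hd := discrim_le_zero (a := (inner ℂ (w : H) (S w)).re) (b := 2 * c n)
        (c := 1 / ((n : ℝ) + 1)) fun t => by
          have h1 := hm_le (u n + (t : ℂ) • w)
          rw [energy_add_smul hS.2] at h1
          simp only [hc]
          linarith [hu n]
      rw [discrim] at hd
      linarith
    have hc0 : Tendsto (fun n => c n ^ 2) atTop (𝓝 0) :=
      squeeze_zero (fun n => sq_nonneg _) hc_le (by simpa using hδ.const_mul _)
    have hlim : Tendsto c atTop (𝓝 ((inner ℂ f (S w)).re - (inner ℂ h (w : H)).re)) :=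
      ((Complex.continuous_re.tendsto _).comp (hf.inner tendsto_const_nhds)).sub_const _
    have := tendsto_nhds_unique (hlim.pow 2) hc0
    exact sub_eq_zero.1 (pow_eq_zero_iff two_ne_zero |>.1 this)
  intro w
  refine Complex.ext (hre w).symm ?_
  have := hre (Complex.I • w)
  rw [LinearPMap.map_smul, Submodule.coe_smul, inner_smul_right, inner_smul_right,
    Complex.I_mul_re, Complex.I_mul_re] at this
  exact (neg_injective this).symm

/-- The form closure of the domain of a strictly positive operator meets `ker S*` only in `0`. -/
theorem IsFormLimit.eq_zero [CompleteSpace H] (hS : IsSymm S) (hpos : IsStrictlyPositive S) {f : H}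
    (hf : IsFormLimit S f) (hker : f ∈ kernel S†) : f = 0 := by
  have hnonneg := hpos.isNonneg
  obtain ⟨ε, hε, hpos⟩ := hpos
  obtain ⟨u, hu, hu'⟩ := hf
  rw [mem_kernel_adjoint_iff hS.1] at hker
  suffices hle : ε * ‖f‖ ^ 2 ≤ 0 by
    have : ‖f‖ ^ 2 ≤ 0 := nonpos_of_mul_nonpos_right hle hε
    simpa using le_antisymm this (sq_nonneg _)
  refine le_of_forall_pos_le_add fun η hη => ?_
  rw [zero_add]
  obtain ⟨⟨a, b⟩, hab⟩ := eventually_atTop.1 (hu'.eventually_lt_const hη)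
  -- Polarization bounds `Re ⟪u m, S (u b)⟫` below; it tends to `Re ⟪f, S (u b)⟫ = 0`.
  have hpol : ∀ m ≥ a, ε * ‖(u m : H)‖ ^ 2 ≤ η + 2 * (inner ℂ (u m : H) (S (u b))).re := by
    intro m hm
    have h1 := hab (m, b) ⟨hm, le_rfl⟩
    have h2 := hpos (u m)
    have h3 := hnonneg (u b)
    have h4 := re_inner_comm hS.2 (u m) (u b)
    simp only [LinearPMap.map_sub, Submodule.coe_sub, inner_sub_left, inner_sub_right,
      Complex.sub_re] at h1
    linarith
  have hl : Tendsto (fun m => ε * ‖(u m : H)‖ ^ 2) atTop (𝓝 (ε * ‖f‖ ^ 2)) :=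
    (hu.norm.pow 2).const_mul ε
  have hr : Tendsto (fun m => η + 2 * (inner ℂ (u m : H) (S (u b))).re) atTop
      (𝓝 (η + 2 * (inner ℂ f (S (u b))).re)) :=
    (((Complex.continuous_re.tendsto _).comp
      (hu.inner tendsto_const_nhds)).const_mul 2).const_add η
  have := le_of_tendsto_of_tendsto hl hr (eventually_atTop.2 ⟨a, hpol⟩)
  simpa [hker (u b)] using this

theorem mem_graph_friedrichs_iff [CompleteSpace H] (hS : IsNonneg S) (x y : H) :
    (x, y) ∈ (friedrichs S hS).graph ↔ IsFormLimit S x ∧ (x, y) ∈ S†.graph :=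
  mem_graph_domRestrict_iff _ _ _ _

theorem mem_graph_inverse_friedrichs_iff [CompleteSpace H] (hS : IsSymm S)
    (hpos : IsStrictlyPositive S) (x y : H) :
    (y, x) ∈ (friedrichs S hpos.isNonneg).inverse.graph ↔
      IsFormLimit S x ∧ (x, y) ∈ S†.graph := by
  rw [mem_graph_inverse_iff, mem_graph_friedrichs_iff]
  rw [LinearMap.ker_eq_bot']
  intro z hz
  have h := (mem_graph_friedrichs_iff hpos.isNonneg _ _).1 (LinearPMap.mem_graph _ z)
  change friedrichs S hpos.isNonneg z = 0 at hz
  rw [hz, ← mem_kernel_iff] at h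
  exact Subtype.ext (h.1.eq_zero hS hpos h.2)

/-! ### The range of a strictly positive closed operator -/

theorem isClosed_range [CompleteSpace H] (hclosed : S.IsClosed) (hpos : IsStrictlyPositive S) :
    IsClosed (LinearMap.range S.toFun : Set H) := by
  obtain ⟨ε, hε, hpos⟩ := hpos
  have hbound : ∀ v : S.domain, ε * ‖(v : H)‖ ≤ ‖S v‖ := by
    intro v
    rcases (norm_nonneg (v : H)).eq_or_lt with h0 | h0
    · rw [← h0, mul_zero]
      exact norm_nonneg _
    · refine le_of_mul_le_mul_right ?_ h0
      calc ε * ‖(v : H)‖ * ‖(v : H)‖ = ε * ‖(v : H)‖ ^ 2 := by ring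
        _ ≤ (inner ℂ (v : H) (S v)).re := hpos v
        _ ≤ ‖(v : H)‖ * ‖S v‖ := (Complex.re_le_norm _).trans (norm_inner_le_norm _ _)
        _ = ‖S v‖ * ‖(v : H)‖ := mul_comm _ _
  refine isClosed_of_closure_subset fun y hy => ?_
  obtain ⟨w, hw, hlim⟩ := mem_closure_iff_seq_limit.1 hy
  choose v hv using hw
  have hv' : ∀ n, S (v n) = w n := hv
  have hcauchy : CauchySeq fun n => (v n : H) := by
    have hw0 := cauchySeq_iff_tendsto_dist_atTop_0.1 hlim.cauchySeq
    rw [cauchySeq_iff_tendsto_dist_atTop_0]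
    refine squeeze_zero (fun _ => dist_nonneg) (fun p => ?_)
      (by simpa using hw0.div_const ε)
    rw [le_div_iff₀ hε, mul_comm, dist_eq_norm, dist_eq_norm, ← hv', ← hv', ← LinearPMap.map_sub]
    exact hbound (v p.1 - v p.2)
  obtain ⟨x, hx⟩ := cauchySeq_tendsto_of_complete hcauchy
  have hmem : (x, y) ∈ S.graph :=
    IsClosed.mem_of_tendsto hclosed (hx.prodMk_nhds hlim)
      (Eventually.of_forall fun n => by rw [← hv']; exact S.mem_graph (v n))
  obtain ⟨z, -, hz⟩ := (LinearPMap.mem_graph_iff S).1 hmem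
  exact ⟨z, hz⟩

theorem orthogonal_kernel_adjoint [CompleteSpace H] (hS : Dense (S.domain : Set H))
    (hclosed : S.IsClosed) (hpos : IsStrictlyPositive S) :
    (kernel S†)ᗮ = LinearMap.range S.toFun := by
  have h : kernel S† = (LinearMap.range S.toFun)ᗮ := by
    ext x
    rw [mem_kernel_adjoint_iff hS, Submodule.mem_orthogonal']
    exact ⟨fun h => by rintro _ ⟨v, rfl⟩; exact h v, fun h v => h _ ⟨v, rfl⟩⟩
  rw [h, Submodule.orthogonal_orthogonal_eq_closure]
  exact IsClosed.submodule_topologicalClosure_eq (isClosed_range hclosed hpos)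

/-! ### The graph of the extension -/

/-- A description of `S_B` by the boundary components of `x`: the element `k ∈ D(B)` is the
`ker S*`-component of `x` modulo the form closure, and `B k` is the projection of `S* x` to the
closure of `D(B)`. -/
theorem mem_graph_extension_iff [CompleteSpace H] (hS : IsSymm S) (hclosed : S.IsClosed)
    (hpos : IsStrictlyPositive S) {B : H →ₗ.[ℂ] H} (hker : B.domain ≤ kernel S†) (x y : H) :
    (x, y) ∈ (extension S hpos.isNonneg B).graph ↔ (x, y) ∈ S†.graph ∧
      ∃ k : B.domain, IsFormLimit S (x - k) ∧ y - B k ∈ B.domainᗮ := by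
  rw [extension, mem_graph_domRestrict_iff, and_comm]
  refine and_congr_right fun hxy => ?_
  have hkerB : ∀ k : B.domain, ((k : H), (0 : H)) ∈ S†.graph := fun k =>
    (mem_kernel_iff _ _).1 (hker k.2)
  simp only [extensionDomain, Submodule.mem_sup, mem_shiftedRange_iff, mem_imageOf_iff,
    mem_graph_inverse_friedrichs_iff hS hpos]
  constructor
  · rintro ⟨_, ⟨s, hs, _, ⟨k, a, ⟨ha, haB⟩, rfl⟩, rfl⟩, b, ⟨η, ⟨hη, -⟩, hb, hbη⟩, rfl⟩
    refine ⟨k, ?_, ?_⟩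
    · have h := add_mem (add_mem
        (show s ∈ formClosure S hpos.isNonneg from IsFormLimit.of_mem_domain ⟨s, hs⟩)
        (show a ∈ formClosure S hpos.isNonneg from ha))
        (show b ∈ formClosure S hpos.isNonneg from hb)
      convert! h using 1
      abel
    · -- `S* x = S s + B k + η`, and `S s` is orthogonal to `ker S*`, which contains `D(B)`.
      have h := add_mem (add_mem (hS.mem_graph_adjoint ⟨s, hs⟩) (add_mem haB (hkerB k))) hbη
      have hy : y = S ⟨s, hs⟩ + (B k + 0) + η := LinearPMap.mem_graph_snd_inj _ hxy h rfl
      have hs' : S ⟨s, hs⟩ ∈ B.domainᗮ := by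
        rw [Submodule.mem_orthogonal]
        exact fun w hw => (mem_kernel_adjoint_iff hS.1 w).1 (hker hw) _
      rw [hy, show S ⟨s, hs⟩ + (B k + 0) + η - B k = S ⟨s, hs⟩ + η by abel]
      exact add_mem hs' hη
  · rintro ⟨k, hk, hyk⟩
    -- Split `y - B k` along `ker S* ⊕ ran S` as `η + S s`; then `x - k = S_F⁻¹ (B k + η) + s`.
    have hcl : IsClosed (kernel S† : Set H) := by
      have : (kernel S† : Set H) = ⋂ v : S.domain, {x | inner ℂ x (S v) = 0} := by
        ext x
        simp only [SetLike.mem_coe, mem_kernel_adjoint_iff hS.1, Set.mem_iInter]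
        rfl
      rw [this]
      exact isClosed_iInter fun v => isClosed_eq (by fun_prop) continuous_const
    have : CompleteSpace (kernel S†) := hcl.completeSpace_coe
    set η := (kernel S†).starProjection (y - B k) with hη
    have hsub : y - B k - η ∈ (kernel S†)ᗮ :=
      (kernel S†).sub_starProjection_mem_orthogonal _
    have hηB : η ∈ B.domainᗮ := by
      have := sub_mem hyk (Submodule.orthogonal_le hker hsub)
      rwa [sub_sub_cancel] at this
    have hηker : η ∈ kernel S† := Submodule.starProjection_apply_mem _ _
    rw [orthogonal_kernel_adjoint hS.1 hclosed hpos] at hsub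
    obtain ⟨s, hs⟩ := hsub
    obtain ⟨a, ha, ha'⟩ := exists_isFormLimit_mem_graph_adjoint hS hpos (B k)
    obtain ⟨b, hb, hb'⟩ := exists_isFormLimit_mem_graph_adjoint hS hpos η
    refine ⟨s + (a + k), ⟨s, s.2, a + k, ⟨k, a, ⟨ha, ha'⟩, rfl⟩, rfl⟩, b,
      ⟨η, ⟨hηB, hηker⟩, hb, hb'⟩, ?_⟩
    have hform : s + a + b - (x - k) ∈ formClosure S hpos.isNonneg :=
      sub_mem (add_mem (add_mem (IsFormLimit.of_mem_domain s) ha) hb) hk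
    have hgraph := sub_mem (add_mem (add_mem (hS.mem_graph_adjoint s) ha') hb')
      (sub_mem hxy (hkerB k))
    have hval : S s + B k + η - (y - 0) = 0 := by
      rw [show S s = y - B k - η from hs]
      abel
    have h0 : (s + a + b - (x - k) : H) = 0 := by
      refine IsFormLimit.eq_zero hS hpos hform ((mem_kernel_iff _ _).2 ?_)
      rw [← hval]
      exact hgraph
    rw [← sub_eq_zero, ← h0]
    abel

end Friedrichs

/-! ### Invariance under a boundedly invertible operator -/

section Invariance

variable (u : (H →L[ℂ] H)ˣ)

theorem units_inv_apply (x : H) : (↑u⁻¹ : H →L[ℂ] H) ((u : H →L[ℂ] H) x) = x := by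
  rw [← mul_apply_eq_comp, u.inv_mul, one_apply_eq_self]

theorem units_apply_inv (x : H) : (u : H →L[ℂ] H) ((↑u⁻¹ : H →L[ℂ] H) x) = x :=
  units_inv_apply u⁻¹ x

variable [CompleteSpace H]

theorem adjoint_units_apply_inv (x : H) : ContinuousLinearMap.adjoint (u : H →L[ℂ] H)
    (ContinuousLinearMap.adjoint (↑u⁻¹ : H →L[ℂ] H) x) = x := by
  refine ext_inner_right ℂ fun y => ?_
  rw [ContinuousLinearMap.adjoint_inner_left, ContinuousLinearMap.adjoint_inner_left,
    units_inv_apply]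

theorem adjoint_units_inv_apply (x : H) : ContinuousLinearMap.adjoint (↑u⁻¹ : H →L[ℂ] H)
    (ContinuousLinearMap.adjoint (u : H →L[ℂ] H) x) = x :=
  adjoint_units_apply_inv u⁻¹ x

theorem mem_graph_conj_iff (T : H →ₗ.[ℂ] H) (x y : H) :
    (x, y) ∈ (conj (u : H →L[ℂ] H) T).graph ↔
      ((u : H →L[ℂ] H) x, ContinuousLinearMap.adjoint (↑u⁻¹ : H →L[ℂ] H) y) ∈ T.graph := by
  simp only [LinearPMap.mem_graph_iff]
  constructor
  · rintro ⟨z, rfl, rfl⟩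
    exact ⟨⟨_, z.2⟩, rfl, (adjoint_units_inv_apply u _).symm⟩
  · rintro ⟨z, hz, hz'⟩
    have hx : (u : H →L[ℂ] H) x ∈ T.domain := hz ▸ z.2
    obtain rfl : z = ⟨_, hx⟩ := Subtype.ext hz
    refine ⟨⟨x, hx⟩, rfl, ?_⟩
    change ContinuousLinearMap.adjoint (u : H →L[ℂ] H) (T ⟨_, hx⟩) = y
    rw [hz', adjoint_units_apply_inv]

theorem isKInvariant_iff (T : H →ₗ.[ℂ] H) : IsKInvariant (u : H →L[ℂ] H) T ↔ ∀ x y,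
    ((u : H →L[ℂ] H) x, ContinuousLinearMap.adjoint (↑u⁻¹ : H →L[ℂ] H) y) ∈ T.graph ↔
      (x, y) ∈ T.graph := by
  simp only [← mem_graph_conj_iff]
  constructor
  · intro h x y
    rw [show conj (u : H →L[ℂ] H) T = T from h]
  · exact fun h => LinearPMap.eq_of_eq_graph (Submodule.ext fun p => h p.1 p.2)

variable {u}

theorem IsKInvariant.inv {T : H →ₗ.[ℂ] H} (h : IsKInvariant (u : H →L[ℂ] H) T) :
    IsKInvariant (↑u⁻¹ : H →L[ℂ] H) T := by
  rw [isKInvariant_iff] at h ⊢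
  intro x y
  rw [← h, units_apply_inv, inv_inv, adjoint_units_inv_apply]

variable {S : H →ₗ.[ℂ] H}

theorem IsKInvariant.adjoint_graph (hS : Dense (S.domain : Set H))
    (h : IsKInvariant (u : H →L[ℂ] H) S) {x y : H} (hxy : (x, y) ∈ S†.graph) :
    ((u : H →L[ℂ] H) x, ContinuousLinearMap.adjoint (↑u⁻¹ : H →L[ℂ] H) y) ∈ S†.graph := by
  rw [mem_graph_adjoint_iff hS] at hxy ⊢
  intro v
  have hv := (isKInvariant_iff _ _).1 h.inv _ _ |>.2 (S.mem_graph v)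
  rw [inv_inv] at hv
  obtain ⟨w, hw, hw'⟩ := (LinearPMap.mem_graph_iff S).1 hv
  dsimp only at hw hw'
  rw [ContinuousLinearMap.adjoint_inner_left, ← ContinuousLinearMap.adjoint_inner_right, ← hw',
    ← hw]
  exact hxy w

theorem IsKInvariant.isFormLimit (h : IsKInvariant (u : H →L[ℂ] H) S) {f : H}
    (hf : IsFormLimit S f) : IsFormLimit S ((u : H →L[ℂ] H) f) := by
  obtain ⟨v, hv, hv'⟩ := hf
  have hex : ∀ w : S.domain, ∃ z : S.domain, (z : H) = (u : H →L[ℂ] H) w ∧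
      S z = ContinuousLinearMap.adjoint (↑u⁻¹ : H →L[ℂ] H) (S w) := fun w =>
    (LinearPMap.mem_graph_iff S).1 ((isKInvariant_iff _ _).1 h _ _ |>.2 (S.mem_graph w))
  choose z hz hz' using hex
  refine ⟨fun n => z (v n), ?_, hv'.congr fun p => ?_⟩
  · simp only [hz]
    exact ((u : H →L[ℂ] H).continuous.tendsto f).comp hv
  · simp only [LinearPMap.map_sub, Submodule.coe_sub, hz, hz', ← map_sub]
    rw [ContinuousLinearMap.adjoint_inner_right, units_inv_apply]

/-! ### Operators intertwined up to the orthogonal complement of the domain -/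

variable (u) in
/-- The operator `K` maps `D(B)` into itself, and `(K⁻¹)* B` and `B K` agree on `D(B)` up to
vectors orthogonal to `D(B)`. -/
def Intertwines (B : H →ₗ.[ℂ] H) : Prop :=
  ∀ k : B.domain, ∃ hk : (u : H →L[ℂ] H) k ∈ B.domain,
    ContinuousLinearMap.adjoint (↑u⁻¹ : H →L[ℂ] H) (B k) - B ⟨(u : H →L[ℂ] H) k, hk⟩ ∈ B.domainᗮ

theorem adjoint_mem_orthogonal {A : H →L[ℂ] H} {N : Submodule ℂ H} (hA : ∀ x ∈ N, A x ∈ N) {y : H}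
    (hy : y ∈ Nᗮ) : ContinuousLinearMap.adjoint A y ∈ Nᗮ := by
  rw [Submodule.mem_orthogonal] at hy ⊢
  intro x hx
  rw [ContinuousLinearMap.adjoint_inner_right]
  exact hy _ (hA x hx)

/-- Applying `K*` turns the intertwining relations for `K` and `K⁻¹` into a statement about the
compression of `K* B K`. -/
theorem intertwines_and_inv_iff {B : H →ₗ.[ℂ] H}
    (hran : ∀ f : B.domain, B f ∈ B.domain.topologicalClosure) :
    Intertwines u B ∧ Intertwines u⁻¹ B ↔ B.domain = (conj (u : H →L[ℂ] H) B).domain ∧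
      compression B (conj (u : H →L[ℂ] H) B) = B := by
  have hproj : ∀ (x : H) (k : B.domain),
      B.domain.topologicalClosure.starProjection x = B k ↔ x - B k ∈ B.domainᗮ := by
    intro x k
    rw [← B.domain.orthogonal_closure]
    constructor
    · intro h
      rw [← h]
      exact Submodule.sub_starProjection_mem_orthogonal _
    · exact Submodule.eq_starProjection_of_mem_orthogonal (hran k)
  constructor
  · rintro ⟨h, h'⟩
    have hdom : B.domain = (conj (u : H →L[ℂ] H) B).domain := by
      ext x
      refine ⟨fun hx => (h ⟨x, hx⟩).1, fun hx => ?_⟩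
      have := (h' ⟨(u : H →L[ℂ] H) x, hx⟩).1
      rwa [units_inv_apply] at this
    refine ⟨hdom, LinearPMap.ext ?_ fun k hk hk' => ?_⟩
    · change B.domain ⊓ (conj (u : H →L[ℂ] H) B).domain = B.domain
      rw [← hdom, inf_idem]
    · obtain ⟨hm, ho⟩ := h ⟨k, hk'⟩
      refine (hproj (ContinuousLinearMap.adjoint (u : H →L[ℂ] H) (B ⟨_, hm⟩)) ⟨k, hk'⟩).2 ?_
      have := neg_mem (adjoint_mem_orthogonal (fun x hx => (h ⟨x, hx⟩).1) ho)
      rwa [map_sub, adjoint_units_apply_inv, neg_sub] at this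
  · rintro ⟨hdom, hcomp⟩
    have hmem : ∀ x, x ∈ B.domain ↔ (u : H →L[ℂ] H) x ∈ B.domain := fun x =>
      SetLike.ext_iff.1 hdom x
    have hinv : ∀ x ∈ B.domain, (↑u⁻¹ : H →L[ℂ] H) x ∈ B.domain := fun x hx => by
      rwa [hmem, units_apply_inv]
    have hval : ∀ (k : B.domain) (hk : (u : H →L[ℂ] H) k ∈ B.domain),
        ContinuousLinearMap.adjoint (u : H →L[ℂ] H) (B ⟨_, hk⟩) - B k ∈ B.domainᗮ := fun k hk =>
      (hproj _ _).1 ((LinearPMap.dExt_iff.1 hcomp).2 (x := ⟨k, k.2, hk⟩) (y := k) rfl)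
    refine ⟨fun k => ⟨(hmem _).1 k.2, ?_⟩, fun k => ⟨hinv _ k.2, ?_⟩⟩
    · have := neg_mem (adjoint_mem_orthogonal hinv (hval k ((hmem _).1 k.2)))
      rwa [map_sub, adjoint_units_inv_apply, neg_sub] at this
    · have := hval ⟨_, hinv _ k.2⟩ ((units_apply_inv u k).symm ▸ k.2)
      simp only [units_apply_inv] at this
      rwa [inv_inv]

/-! ### Invariance of the extension -/

variable {B : H →ₗ.[ℂ] H}

theorem IsKInvariant.intertwines (hS : IsSymm S) (hclosed : S.IsClosed)
    (hpos : IsStrictlyPositive S) (hinv : IsKInvariant (u : H →L[ℂ] H) S)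
    (hker : B.domain ≤ kernel S†)
    (h : IsKInvariant (u : H →L[ℂ] H) (extension S hpos.isNonneg B)) : Intertwines u B := by
  intro k
  obtain ⟨a, ha, ha'⟩ := exists_isFormLimit_mem_graph_adjoint hS hpos (B k)
  have hkg : ((k : H), (0 : H)) ∈ S†.graph := (mem_kernel_iff _ _).1 (hker k.2)
  have hmem : (a + k, B k) ∈ (extension S hpos.isNonneg B).graph := by
    refine (mem_graph_extension_iff hS hclosed hpos hker _ _).2 ⟨?_, k, ?_, ?_⟩
    · have := add_mem ha' hkg
      rwa [Prod.mk_add_mk, add_zero] at this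
    · rwa [add_sub_cancel_right]
    · rw [sub_self]
      exact zero_mem _
  obtain ⟨-, k', hk', ho⟩ := (mem_graph_extension_iff hS hclosed hpos hker _ _).1
    ((isKInvariant_iff _ _).1 h _ _ |>.2 hmem)
  -- `K k - k'` lies both in the form closure and in `ker S*`.
  have hkk : (u : H →L[ℂ] H) k = k' := by
    rw [← sub_eq_zero]
    have hform : (u : H →L[ℂ] H) (a + k) - k' - (u : H →L[ℂ] H) a ∈
        formClosure S hpos.isNonneg := sub_mem hk' (hinv.isFormLimit ha)
    rw [map_add, show (u : H →L[ℂ] H) a + (u : H →L[ℂ] H) k - k' - (u : H →L[ℂ] H) a =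
      (u : H →L[ℂ] H) k - k' by abel] at hform
    refine IsFormLimit.eq_zero hS hpos hform (sub_mem ?_ (hker k'.2))
    have := hinv.adjoint_graph hS.1 hkg
    rwa [map_zero, ← mem_kernel_iff] at this
  have hmemK : (u : H →L[ℂ] H) k ∈ B.domain := hkk ▸ k'.2
  obtain rfl : k' = ⟨_, hmemK⟩ := Subtype.ext hkk.symm
  exact ⟨hmemK, ho⟩

theorem Intertwines.mem_graph_extension (hS : IsSymm S) (hclosed : S.IsClosed)
    (hpos : IsStrictlyPositive S) (hinv : IsKInvariant (u : H →L[ℂ] H) S)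
    (hker : B.domain ≤ kernel S†) (h : Intertwines u B) (h' : Intertwines u⁻¹ B) {x y : H}
    (hxy : (x, y) ∈ (extension S hpos.isNonneg B).graph) :
    ((u : H →L[ℂ] H) x, ContinuousLinearMap.adjoint (↑u⁻¹ : H →L[ℂ] H) y) ∈
      (extension S hpos.isNonneg B).graph := by
  rw [mem_graph_extension_iff hS hclosed hpos hker] at hxy ⊢
  obtain ⟨hg, k, hk, ho⟩ := hxy
  obtain ⟨hm, hmo⟩ := h k
  refine ⟨hinv.adjoint_graph hS.1 hg, ⟨_, hm⟩, ?_, ?_⟩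
  · have := hinv.isFormLimit hk
    rwa [map_sub] at this
  · have := add_mem (adjoint_mem_orthogonal (fun x hx => (h' ⟨x, hx⟩).1) ho) hmo
    rwa [map_sub, sub_add_sub_cancel] at this

theorem isKInvariant_extension_iff (hS : IsSymm S) (hclosed : S.IsClosed)
    (hpos : IsStrictlyPositive S) (hinv : IsKInvariant (u : H →L[ℂ] H) S)
    (hker : B.domain ≤ kernel S†) :
    IsKInvariant (u : H →L[ℂ] H) (extension S hpos.isNonneg B) ↔
      Intertwines u B ∧ Intertwines u⁻¹ B := by
  constructor
  · exact fun h => ⟨hinv.intertwines hS hclosed hpos hker h,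
      hinv.inv.intertwines hS hclosed hpos hker h.inv⟩
  · rintro ⟨h, h'⟩
    refine (isKInvariant_iff _ _).2 fun x y => ⟨fun hxy => ?_, fun hxy => ?_⟩
    · have := h'.mem_graph_extension hS hclosed hpos hinv.inv hker (by rwa [inv_inv]) hxy
      rwa [units_inv_apply, inv_inv, adjoint_units_apply_inv] at this
    · exact h.mem_graph_extension hS hclosed hpos hinv hker h' hxy

end Invariance

end KInvariance

theorem mainTheorem2 {H : Type*} [NormedAddCommGroup H] [InnerProductSpace ℂ H] [CompleteSpace H]
    (K : H →L[ℂ] H) (hK : IsUnit K)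
    (S : H →ₗ.[ℂ] H) (hsymm : KInvariance.IsSymm S) (hclosed : S.IsClosed)
    (hpos : KInvariance.IsStrictlyPositive S) (hinv : KInvariance.IsKInvariant K S)
    (B : H →ₗ.[ℂ] H) (hker : B.domain.topologicalClosure ≤ KInvariance.kernel S†)
    (hran : ∀ f : B.domain, B f ∈ B.domain.topologicalClosure)
    (hB : KInvariance.IsNonnegSelfAdjoint (KInvariance.inClosure B hran) ∨
      KInvariance.IsMaximallyDissipative (KInvariance.inClosure B hran)) :
    KInvariance.IsKInvariant K (KInvariance.extension S hpos.isNonneg B) ↔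
      B.domain = (KInvariance.conj K B).domain ∧
        KInvariance.compression B (KInvariance.conj K B) = B := by
  obtain ⟨u, rfl⟩ := hK
  rw [KInvariance.isKInvariant_extension_iff hsymm hclosed hpos hinv
    (B.domain.le_topologicalClosure.trans hker), KInvariance.intertwines_and_inv_iff hran]
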